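/- Let $X$ be a metric space and $\epsilon>0$ a real number. A continuous map $f:X\to K$ is an $\epsilon$-embedding if $\operatorname{Diam} f^{-1}(y)\le\epsilon$ for all $y\in K$. Let $\mathrm{wdim}_\epsilon X$ be the smallest $k$ (possibly $\infty$) such that there is an $\epsilon$-embedding of $X$ into a $k$-dimensional polyhedron, where a polyhedron is the underlying space of a (not necessarily finite) simplicial complex, with the weak topology. Let $\mathrm{wspec}\,X=\{\mathrm{wdim}_\epsilon X : \epsilon>0\}$. Let $1\le p<\infty$, let $n$ be a natural number, and let $B=\{x\in\mathbb{R}^n : (\sum_{i=1}^n|x_i|^p)^{1/p}\le 1\}$ be the closed $l^p$ unit ball, equipped with the sup metric $d(x,y)=\max_i|x_i-y_i|$. Then $\mathrm{wspec}\,B=\{0,1,\dots,n\}$ and, for every real $\epsilon>0$, \[ \mathrm{wdim}_\epsilon B= \begin{cases} 0 & \text{if } 2\le\epsilon,\\ k & \text{if } 2(k+1)^{-1/p}\le\epsilon<2k^{-1/p}\ \text{ for an integer } 1\le k<n,\\ n & \text{if } n\ge 1 \text{ and } \epsilon<2n^{-1/p}. \end{cases} \] -/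

import Mathlib

universe u

open Geometry

/-- The dimension of a simplicial complex: the supremum of the dimensions `#s - 1` of its simplices
(equal to `⊤` if these are unbounded). -/
noncomputable def Geometry.SimplicialComplex.dimension {E : Type u} [AddCommGroup E] [Module ℝ E]
    (K : SimplicialComplex ℝ E) : ℕ∞ :=
  ⨆ s ∈ K.faces, ((s.card - 1 : ℕ) : ℕ∞)

/-- The polyhedron of a (possibly infinite) simplicial complex: the union of its closed simplices.
It is a type of its own since it carries the weak topology defined below. -/
def Geometry.SimplicialComplex.Polyhedron {E : Type u} [AddCommGroup E] [Module ℝ E]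
    (K : SimplicialComplex ℝ E) : Type u :=
  K.space

/-- The parametrization of the closed simplex with vertex set `s` by its barycentric coordinates. -/
def Geometry.SimplicialComplex.simplexMap {E : Type u} [AddCommGroup E] [Module ℝ E]
    (K : SimplicialComplex ℝ E) (s : K.faces) (w : stdSimplex ℝ (s : Finset E)) : K.Polyhedron :=
  ⟨∑ v : (s : Finset E), w.1 v • (v : E),
    K.convexHull_subset_space s.2
      ((convex_convexHull ℝ ((s : Finset E) : Set E)).sum_mem (fun v _ => w.2.1 v) w.2.2
        (fun v _ => subset_convexHull ℝ _ v.2))⟩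

/-- The weak topology of a polyhedron: a set is open (equivalently, closed) if and only if its
trace on every closed simplex is so, for the Euclidean topology of that simplex. -/
instance Geometry.SimplicialComplex.Polyhedron.instTopologicalSpace {E : Type u} [AddCommGroup E]
    [Module ℝ E] (K : SimplicialComplex ℝ E) : TopologicalSpace K.Polyhedron :=
  ⨆ s : K.faces, TopologicalSpace.coinduced (K.simplexMap s) inferInstance

/-- `f` is an `ε`-embedding: it is continuous and all its fibres have diameter at most `ε`. -/
def IsEpsEmbedding {X Y : Type*} [MetricSpace X] [TopologicalSpace Y] (ε : ℝ) (f : X → Y) : Prop :=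
  Continuous f ∧ ∀ y : Y, Metric.ediam (f ⁻¹' {y}) ≤ ENNReal.ofReal ε

/-- `wdim ε X` is the infimum of the dimensions of the polyhedra `K` for which there is an
`ε`-embedding `X → K`. -/
noncomputable def wdim (ε : ℝ) (X : Type u) [MetricSpace X] : ℕ∞ :=
  sInf {d : ℕ∞ | ∃ (E : Type u) (_ : AddCommGroup E) (_ : Module ℝ E) (K : SimplicialComplex ℝ E)
    (f : X → K.Polyhedron), IsEpsEmbedding ε f ∧ K.dimension = d}

/-- The set of the values of `ε ↦ wdim ε X`, `ε > 0`. -/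
def wspec (X : Type u) [MetricSpace X] : Set ℕ∞ :=
  {d : ℕ∞ | ∃ ε : ℝ, 0 < ε ∧ wdim ε X = d}

/-- The closed unit ball of the `l^p` norm in `ℝ^n`. As a subset of `Fin n → ℝ` it carries the
metric `l^∞`, that is, the sup metric. -/
def lpBall (p : ℝ) (n : ℕ) : Set (Fin n → ℝ) :=
  {x | (∑ i, |x i| ^ p) ^ (1 / p) ≤ 1}

/-! Upper bound: let `T x` be the (k+1)-st largest absolute value of the coordinates. Shrinking
every coordinate of `x` towards 0 by `T x` leaves at most `k` nonzero ones. Their positive and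
negative parts, with one slack weight, are barycentric coordinates in a `k`-dimensional complex
(`wdim_le_of_barycentric`). Points with equal image differ by at most `T x + T y` in each
coordinate, and `T ≤ (k+1)^(-1/p)` on the ball (`wdim_lpBall_le`).

Lower bound: the ball contains a `k`-cube of side `2 k^(-1/p)`, so it suffices that a map from a
`k`-cube to a polyhedron of dimension less than `k` identifies two points on opposite faces. By
compactness only finitely many open simplices are met, and barycentric coordinates turn the map into
one to a Euclidean space whose image has Hausdorff dimension less than `k`
(`exists_continuous_dimH_range_le`). If no opposite points were identified, differences of distances
to the images of opposite faces would give a Lipschitz map of this image to `ℝ^k`. Its range would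
miss points arbitrarily near 0, contrary to Poincaré–Miranda
(`exists_opposite_faces_eq_of_dimH_lt`).

Poincaré–Miranda comes from its lattice form. The mod 2 cup product of the coboundaries of the
separating functions, summed over Kuhn's triangulation, depends only on the boundary conditions
(`kuhnSum_eq`) and equals 1 for step functions (`kuhnSum_step`), so some simplex carries a nonzero
term. -/

/-! ### Cup products of coboundaries modulo two. -/

section CupProduct

variable {R V : Type*} [CommRing R]

/-- The `j`-th factor, at the vertex sequence `y`, of the cup product of the coboundaries of the
functions `a j` in which the coboundary of `a i` is replaced by `a i` itself. -/
def cupFactor (a : ℕ → V → R) (i : ℕ) (y : ℕ → V) (j : ℕ) : R :=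
  if j < i then a j (y (j + 1)) + a j (y j)
  else if j = i then a j (y j) else a j (y j) + a j (y (j - 1))

/-- The vertex sequence `y` with its `m`-th entry left out. -/
def omitVertex (m : ℕ) (y : ℕ → V) (j : ℕ) : V := y (if j < m then j else j + 1)

/-- Omitting an inner vertex merges two consecutive edges. Modulo two the coboundary on the merged
edge is the sum over both, so the product splits at the single factor `c`. -/
lemma prod_cupFactor_omit_eq_add (a : ℕ → V → R) (i : ℕ) (y : ℕ → V) {k m c : ℕ} (hc : c < k)
    (h : ∀ j, cupFactor a i (omitVertex m y) j = if j = c then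
      cupFactor a i y j + cupFactor a i (fun l => y (l + 1)) j
      else if j < c then cupFactor a i y j else cupFactor a i (fun l => y (l + 1)) j) :
    ∏ j ∈ Finset.range k, cupFactor a i (omitVertex m y) j =
      ∏ j ∈ Finset.range k,
        (if j < c + 1 then cupFactor a i y j else cupFactor a i (fun l => y (l + 1)) j) +
      ∏ j ∈ Finset.range k,
        (if j < c then cupFactor a i y j else cupFactor a i (fun l => y (l + 1)) j) := by
  refine (Finset.prod_add_prod_eq (Finset.mem_range.2 hc) ?_ ?_ ?_).symm
  · rw [h]; simp
  · intro j _ hj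
    rw [h, if_neg hj]
    congr 1
    simp only [eq_iff_iff]; omega
  · intro j _ hj
    rw [h, if_neg hj]

/-- The Leibniz rule for the coboundary of a cup product, modulo two. -/
lemma sum_cupFactor_omit [CharP R 2] (a : ℕ → V → R) (y : ℕ → V) {k i : ℕ} (hi : i < k) :
    ∑ m ∈ Finset.range (k + 1), ∏ j ∈ Finset.range k, cupFactor a i (omitVertex m y) j =
      ∏ j ∈ Finset.range k, (a j (y (j + 1)) + a j (y j)) := by
  have two : (2 : R) = 0 := CharTwo.two_eq_zero
  set D : ℕ → R := fun m => ∏ j ∈ Finset.range k, cupFactor a i (omitVertex m y) j with hD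
  -- Each inner face contributes two neighbouring terms `Q`, so the sum telescopes. The pairing
  -- shifts by one after index `i`, where the undifferentiated factor consumes no edge; hence `Q i`
  -- and `Q (i + 1)` survive.
  set Q : ℕ → R := fun m => ∏ j ∈ Finset.range k,
    (if j < m then cupFactor a i y j else cupFactor a i (fun l => y (l + 1)) j) with hQ
  have zero : D 0 = Q 0 := by
    simp [hD, hQ, cupFactor, omitVertex]
  have low : ∀ m, m + 1 ≤ i → D (m + 1) = Q (m + 1) + Q m := by
    intro m hm
    refine prod_cupFactor_omit_eq_add a i y (by omega) fun j => ?_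
    rcases lt_trichotomy j m with h | h | h
    · simp [cupFactor, omitVertex, h.ne, h, show j < m + 1 by omega, show j < i by omega]
    · subst h
      simp only [cupFactor, omitVertex, lt_add_iff_pos_right, zero_lt_one, if_true,
        show j < i by omega, lt_irrefl, if_false]
      linear_combination (-a j (y (j + 1))) * two
    · by_cases hjm : j - 1 < m + 1
      · have : j = m + 1 := by omega
        subst this
        rcases hm.lt_or_eq with h' | h'
        · simp [cupFactor, omitVertex, h']
        · simp [cupFactor, omitVertex, h', show i ≠ m by omega, show ¬ i < m by omega]
      · simp [cupFactor, omitVertex, h.ne', show ¬ j < m by omega, show ¬ j < m + 1 by omega,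
          hjm]
  have high : ∀ m, i < m → m < k → D m = Q (m + 1) + Q m := by
    intro m him hm
    refine prod_cupFactor_omit_eq_add a i y hm fun j => ?_
    rcases lt_trichotomy j m with h | h | h
    · have h3 : j - 1 < m := by omega
      by_cases h2 : j + 1 < m
      · simp [cupFactor, omitVertex, h.ne, h, h2, h3]
      · simp [cupFactor, omitVertex, h.ne, h, h3, show ¬ j < i by omega]
    · subst h
      simp only [cupFactor, omitVertex, lt_irrefl, if_false, him.ne', show j - 1 < j by omega,
        if_true, show ¬ j < i by omega, show j - 1 + 1 = j by omega]
      linear_combination (-a j (y j)) * two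
    · have h2 : ¬ j < i := by omega
      have h3 : ¬ j - 1 < m := by omega
      simp [cupFactor, omitVertex, h.ne', show ¬ j < m by omega, h2, h3, show j ≠ i by omega]
  have top : D k = Q k := by
    refine Finset.prod_congr rfl fun j hj => ?_
    have hj : j < k := Finset.mem_range.1 hj
    rw [if_pos hj]
    by_cases h2 : j < i
    · simp [cupFactor, omitVertex, hj, h2, show j + 1 < k by omega]
    · simp [cupFactor, omitVertex, hj, h2, show j - 1 < k by omega]
  have total : ∏ j ∈ Finset.range k, (a j (y (j + 1)) + a j (y j)) = Q (i + 1) + Q i := by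
    refine (Finset.prod_add_prod_eq (Finset.mem_range.2 hi) ?_ ?_ ?_).symm
    · simp [cupFactor, add_comm]
    · intro j _ hj
      rcases lt_or_gt_of_ne hj with h | h
      · simp [cupFactor, h, show j < i + 1 by omega]
      · simp [cupFactor, h.ne', show ¬ j < i + 1 by omega, show ¬ j < i by omega,
          show j - 1 + 1 = j by omega]
    · intro j _ hj
      rcases lt_or_gt_of_ne hj with h | h
      · simp [cupFactor, h]
      · simp [cupFactor, h.ne', show ¬ j < i by omega, show j - 1 + 1 = j by omega]
  have sumLow : ∀ r, r ≤ i → ∑ m ∈ Finset.range (r + 1), D m = Q r := by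
    intro r
    induction r with
    | zero => intro _; simpa using zero
    | succ r ih =>
      intro hr
      rw [Finset.sum_range_succ, ih (by omega), low r hr]
      linear_combination Q r * two
  have sumHigh : ∀ r, i + r < k →
      ∑ m ∈ Finset.range (i + r + 1), D m = Q (i + 1) + Q i + Q (i + r + 1) := by
    intro r
    induction r with
    | zero => intro _; rw [add_zero, sumLow i le_rfl]; linear_combination (-Q (i + 1)) * two
    | succ r ih =>
      intro hr
      rw [Finset.sum_range_succ, show i + (r + 1) = i + r + 1 by ring, ih (by omega),
        high (i + r + 1) (by omega) (by omega)]
      linear_combination Q (i + r + 1) * two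
  change ∑ m ∈ Finset.range (k + 1), D m = _
  rw [total, Finset.sum_range_succ, top]
  have := sumHigh (k - 1 - i) (by omega)
  rw [show i + (k - 1 - i) + 1 = k by omega] at this
  rw [this]
  linear_combination Q k * two

end CupProduct

/-! ### Kuhn's triangulation and the discrete Poincaré–Miranda theorem. -/

section Kuhn

variable {k : ℕ}

/-- The vertices `x, x + e_{σ 0}, x + e_{σ 0} + e_{σ 1}, …` of a simplex of Kuhn's triangulation of
`ℝ ^ k`, where `σ` is the inverse of `τ`. -/
def kuhnVertex (x : Fin k → ℤ) (τ : Equiv.Perm (Fin k)) (m : ℕ) : Fin k → ℤ :=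
  fun i => x i + if (τ i : ℕ) < m then 1 else 0

lemma le_kuhnVertex (x : Fin k → ℤ) (τ : Equiv.Perm (Fin k)) (m : ℕ) (i : Fin k) :
    x i ≤ kuhnVertex x τ m i := by
  unfold kuhnVertex; split_ifs <;> omega

lemma kuhnVertex_le (x : Fin k → ℤ) (τ : Equiv.Perm (Fin k)) (m : ℕ) (i : Fin k) :
    kuhnVertex x τ m i ≤ x i + 1 := by
  unfold kuhnVertex; split_ifs <;> omega

/-- Exchanging two consecutive steps of the lattice path moves only the vertex between them, so the
two simplices share the opposite facet. -/
lemma omitVertex_kuhnVertex_swap (x : Fin k → ℤ) (τ : Equiv.Perm (Fin k)) {m : ℕ}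
    (hm : m + 1 < k) :
    omitVertex (m + 1) (kuhnVertex x
      (τ.trans (Equiv.swap ⟨m, by omega⟩ ⟨m + 1, hm⟩))) =
      omitVertex (m + 1) (kuhnVertex x τ) := by
  have key : ∀ (t : Fin k) (j : ℕ), j ≠ m + 1 →
      ((Equiv.swap (⟨m, by omega⟩ : Fin k) ⟨m + 1, hm⟩ t : ℕ) < j ↔ (t : ℕ) < j) := by
    intro t j hj
    rw [Equiv.swap_apply_def]
    split_ifs with h1 h2
    · subst h1; simp only; omega
    · subst h2; simp only; omega
    · rfl
  funext j i
  have hj : (if j < m + 1 then j else j + 1) ≠ m + 1 := by split_ifs <;> omega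
  simp only [omitVertex, kuhnVertex, Equiv.trans_apply, key _ _ hj]

/-- The facet opposite the first vertex is also the facet opposite the last vertex of the simplex
that starts one step later and takes the first step last. -/
lemma kuhnVertex_rotate {d : ℕ} (x : Fin (d + 1) → ℤ) (τ : Equiv.Perm (Fin (d + 1))) {j : ℕ}
    (hj : j < d + 1) :
    kuhnVertex (kuhnVertex x τ 1) (τ.trans (finRotate (d + 1)).symm) j =
      kuhnVertex x τ (j + 1) := by
  funext i
  obtain ⟨s, hs⟩ := (finRotate (d + 1)).surjective (τ i)
  have h : (τ i : ℕ) = if s = Fin.last d then 0 else (s : ℕ) + 1 := by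
    rw [← hs, coe_finRotate]
  have h' : (finRotate (d + 1)).symm (τ i) = s := by rw [← hs, Equiv.symm_apply_apply]
  simp only [kuhnVertex, Equiv.trans_apply, h', h]
  by_cases hl : s = Fin.last d
  · subst hl
    simp [show ¬ d < j by omega]
  · simp [hl]

lemma prod_cupFactor_congr {R V : Type*} [CommRing R] (a : ℕ → V → R) {i : ℕ} (hi : i < k)
    {y z : ℕ → V} (h : ∀ j < k, y j = z j) :
    ∏ j ∈ Finset.range k, cupFactor a i y j = ∏ j ∈ Finset.range k, cupFactor a i z j := by
  refine Finset.prod_congr rfl fun j hj => ?_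
  have hj : j < k := Finset.mem_range.1 hj
  unfold cupFactor
  split_ifs with h1
  · rw [h j hj, h (j + 1) (by omega)]
  · rw [h j hj]
  · rw [h j hj, h (j - 1) (by omega)]

/-- The sum over Kuhn's triangulation of the cup product of the coboundaries of the `a j`. -/
noncomputable def kuhnSum (k : ℕ) (a : ℕ → (Fin k → ℤ) → ZMod 2) : ZMod 2 :=
  ∑ τ : Equiv.Perm (Fin k), ∑ᶠ x : Fin k → ℤ, ∏ j ∈ Finset.range k,
    (a j (kuhnVertex x τ (j + 1)) + a j (kuhnVertex x τ j))

/-- The lower bound is `-1` because the unit cube at `x` reaches up to `x j + 1`, which must stay in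
the half space of coordinates at most 0. -/
lemma finite_support_of_forall_box {f : (Fin k → ℤ) → ZMod 2} (N : ℤ)
    (h : ∀ x, ∀ j, x j ≤ -1 ∨ N ≤ x j → f x = 0) : f.HasFiniteSupport := by
  refine (Set.finite_Icc (fun _ : Fin k => (0 : ℤ)) (fun _ => N)).subset fun x hx => ?_
  rw [Set.mem_Icc, Pi.le_def, Pi.le_def]
  constructor <;> intro j <;> by_contra hj
  · exact hx (h x j (Or.inl (by omega)))
  · exact hx (h x j (Or.inr (by omega)))

/-- `a j` vanishes on the lower half space of the `j`-th coordinate and is one far above. -/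
def SeparatesFace (N : ℤ) (a : ℕ → (Fin k → ℤ) → ZMod 2) (j : Fin k) : Prop :=
  ∀ x : Fin k → ℤ, (x j ≤ 0 → a j x = 0) ∧ (N ≤ x j → a j x = 1)

lemma SeparatesFace.add_eq_zero {N : ℤ} {a : ℕ → (Fin k → ℤ) → ZMod 2} {j : Fin k}
    (h : SeparatesFace N a j) {x u v : Fin k → ℤ} (hu : x j ≤ u j ∧ u j ≤ x j + 1)
    (hv : x j ≤ v j ∧ v j ≤ x j + 1) (hx : x j ≤ -1 ∨ N ≤ x j) : a j u + a j v = 0 := by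
  rcases hx with hx | hx
  · rw [(h u).1 (by omega), (h v).1 (by omega), add_zero]
  · rw [(h u).2 (by omega), (h v).2 (by omega)]; rfl

lemma finite_support_prod {N : ℤ} {a : ℕ → (Fin k → ℤ) → ZMod 2} (h : ∀ j, SeparatesFace N a j)
    (τ : Equiv.Perm (Fin k)) : (fun x : Fin k → ℤ => ∏ j ∈ Finset.range k,
      (a j (kuhnVertex x τ (j + 1)) + a j (kuhnVertex x τ j))).HasFiniteSupport := by
  refine finite_support_of_forall_box N fun x j hx => ?_
  refine Finset.prod_eq_zero (Finset.mem_range.2 j.2) ?_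
  exact (h j).add_eq_zero ⟨le_kuhnVertex .., kuhnVertex_le ..⟩
    ⟨le_kuhnVertex .., kuhnVertex_le ..⟩ hx

/-- A discrete Stokes theorem: as `a i` vanishes outside a slab, the product is the coboundary of a
finitely supported cochain. Facets cancel in pairs: inner ones by adjacent transpositions, the first
against the last by rotation. -/
lemma kuhnSum_eq_zero {N : ℤ} {a : ℕ → (Fin k → ℤ) → ZMod 2} (i : Fin k)
    (h : ∀ j, j ≠ i → SeparatesFace N a j)
    (hi : ∀ x : Fin k → ℤ, x i ≤ 0 ∨ N ≤ x i → a i x = 0) : kuhnSum k a = 0 := by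
  obtain ⟨d, rfl⟩ : ∃ d, k = d + 1 := ⟨k - 1, by have := i.2; omega⟩
  set D : ℕ → Equiv.Perm (Fin (d + 1)) → (Fin (d + 1) → ℤ) → ZMod 2 := fun m τ x =>
    ∏ j ∈ Finset.range (d + 1), cupFactor a i (omitVertex m (kuhnVertex x τ)) j with hD
  have fin : ∀ m τ, (D m τ).HasFiniteSupport := by
    intro m τ
    refine finite_support_of_forall_box N fun x j hx => ?_
    refine Finset.prod_eq_zero (Finset.mem_range.2 j.2) ?_
    by_cases hj : j = i
    · subst hj
      simp only [cupFactor, lt_irrefl, if_false, if_true, omitVertex]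
      have h1 := le_kuhnVertex x τ (if (j : ℕ) < m then (j : ℕ) else j + 1) j
      have h2 := kuhnVertex_le x τ (if (j : ℕ) < m then (j : ℕ) else j + 1) j
      exact hi _ (by omega)
    · have hj' : (j : ℕ) ≠ i := fun h => hj (Fin.ext h)
      have key := fun u v => (h j hj).add_eq_zero (x := x)
        ⟨le_kuhnVertex x τ u j, kuhnVertex_le x τ u j⟩
        ⟨le_kuhnVertex x τ v j, kuhnVertex_le x τ v j⟩ hx
      simp only [cupFactor, hj', if_false]
      split_ifs <;> exact key _ _
  set T : ℕ → ZMod 2 := fun m => ∑ τ, ∑ᶠ x, D m τ x with hT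
  have sum : kuhnSum (d + 1) a = ∑ m ∈ Finset.range (d + 1 + 1), T m := by
    simp only [hT]
    rw [Finset.sum_comm]
    refine Finset.sum_congr rfl fun τ _ => ?_
    rw [← finsum_sum_comm _ _ fun m _ => fin m τ]
    exact finsum_congr fun x => (sum_cupFactor_omit a (kuhnVertex x τ) i.2).symm
  have mid : ∀ m, m < d → T (m + 1) = 0 := by
    intro m hm
    simp only [hT]
    rw [← finsum_sum_comm _ _ fun τ _ => fin (m + 1) τ]
    refine (finsum_congr fun x => ?_).trans finsum_zero
    set s : Equiv.Perm (Fin (d + 1)) := Equiv.swap ⟨m, by omega⟩ ⟨m + 1, by omega⟩ with hs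
    have hDs : ∀ τ, D (m + 1) (τ.trans s) x = D (m + 1) τ x := fun τ => by
      simp only [hD, hs]
      rw [omitVertex_kuhnVertex_swap x τ (by omega)]
    refine Finset.sum_involution (fun τ _ => τ.trans s) ?_ ?_ (fun _ _ => Finset.mem_univ _) ?_
    · intro τ _
      refine (congrArg (D (m + 1) τ x + ·) (hDs τ)).trans ?_
      exact CharTwo.add_self_eq_zero _
    · intro τ _ _ heq
      have := congrArg (fun e : Equiv.Perm (Fin (d + 1)) => e (τ.symm ⟨m, by omega⟩)) heq
      simp [hs] at this
    · intro τ _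
      ext t
      simp [hs]
  have ends : T 0 = T (d + 1) := by
    simp only [hT]
    have hrot : ∀ τ x, D 0 τ x =
        D (d + 1) (τ.trans (finRotate (d + 1)).symm) (kuhnVertex x τ 1) := by
      intro τ x
      refine prod_cupFactor_congr a i.2 fun j hj => ?_
      simp only [omitVertex, hj, if_true, not_lt_zero, if_false]
      exact (kuhnVertex_rotate x τ hj).symm
    have hshift : ∀ τ, ∑ᶠ x, D 0 τ x =
        ∑ᶠ x, D (d + 1) (τ.trans (finRotate (d + 1)).symm) x := by
      intro τ
      -- For fixed `τ`, passing to the second vertex is a translation of the lattice.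
      refine Eq.trans ?_ (finsum_comp_equiv (Equiv.addRight (kuhnVertex 0 τ 1)))
      refine finsum_congr fun x => ?_
      rw [hrot]
      congr 1
      funext t
      simp [kuhnVertex]
    rw [Finset.sum_congr rfl fun τ _ => hshift τ]
    refine Fintype.sum_equiv (Equiv.mulLeft (finRotate (d + 1)).symm) _ _ fun τ => ?_
    rfl
  rw [sum, Finset.sum_range_succ, Finset.sum_range_succ', ends,
    Finset.sum_eq_zero fun m hm => mid m (Finset.mem_range.1 hm), zero_add]
  exact CharTwo.add_self_eq_zero _

/-- The sum is additive in the `i`-th function, and `a i + b i` vanishes on both half spaces, so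
`kuhnSum_eq_zero` applies to the difference. -/
lemma kuhnSum_eq_of_eq_off {N : ℤ} {a b : ℕ → (Fin k → ℤ) → ZMod 2} (i : Fin k)
    (ha : ∀ j, SeparatesFace N a j) (hb : ∀ j, SeparatesFace N b j)
    (hab : ∀ j : ℕ, j ≠ i → a j = b j) : kuhnSum k a = kuhnSum k b := by
  rw [← CharTwo.add_eq_zero]
  have hc := kuhnSum_eq_zero (N := N) (a := Function.update a i (a i + b i)) i
    (fun j hj x => by
      rw [Function.update_of_ne (fun h => hj (Fin.ext h))]; exact ha j x)
    (fun x hx => by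
      rw [Function.update_self, Pi.add_apply]
      rcases hx with hx | hx
      · rw [(ha i x).1 hx, (hb i x).1 hx]; rfl
      · rw [(ha i x).2 hx, (hb i x).2 hx]; rfl)
  rw [← hc]
  unfold kuhnSum
  rw [← Finset.sum_add_distrib]
  refine Finset.sum_congr rfl fun τ _ => ?_
  rw [← finsum_add_distrib (finite_support_prod ha τ) (finite_support_prod hb τ)]
  refine finsum_congr fun x => ?_
  refine Finset.prod_add_prod_eq (Finset.mem_range.2 i.2) ?_ ?_ ?_
  · simp only [Function.update_self, Pi.add_apply]; ring
  · intro j _ hj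
    rw [Function.update_of_ne hj]
  · intro j _ hj
    rw [Function.update_of_ne hj, hab j hj]

lemma kuhnSum_eq {N : ℤ} {a b : ℕ → (Fin k → ℤ) → ZMod 2}
    (ha : ∀ j, SeparatesFace N a j) (hb : ∀ j, SeparatesFace N b j) :
    kuhnSum k a = kuhnSum k b := by
  have hsep : ∀ r j, SeparatesFace N (fun l => if l < r then b l else a l) (j : Fin k) := by
    intro r j x
    by_cases h : (j : ℕ) < r
    · simpa [h] using hb j x
    · simpa [h] using ha j x
  have key : ∀ r ≤ k, kuhnSum k a = kuhnSum k (fun l => if l < r then b l else a l) := by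
    intro r
    induction r with
    | zero => simp
    | succ r ih =>
      intro hr
      rw [ih (by omega)]
      refine kuhnSum_eq_of_eq_off ⟨r, hr⟩ (hsep r) (hsep (r + 1)) fun j hj => ?_
      simp only at hj
      by_cases h : j < r
      · simp [h, show j < r + 1 by omega]
      · simp [h, show ¬ j < r + 1 by omega]
  rw [key k le_rfl]
  unfold kuhnSum
  refine Finset.sum_congr rfl fun τ _ => finsum_congr fun x => Finset.prod_congr rfl fun j hj => ?_
  simp [Finset.mem_range.1 hj]

/-- Factor `j` is nonzero only if the path crosses from 0 to 1 in coordinate `j` exactly at step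
`j`. This singles out the simplex with `τ = 1` and `x = 0`. -/
lemma kuhnSum_step : kuhnSum k
    (fun j x => if h : j < k then if 1 ≤ x ⟨j, h⟩ then 1 else 0 else 0) = 1 := by
  have key : ∀ (τ : Equiv.Perm (Fin k)) (x : Fin k → ℤ), ∏ j ∈ Finset.range k,
      ((if h : j < k then if 1 ≤ kuhnVertex x τ (j + 1) ⟨j, h⟩ then (1 : ZMod 2) else 0 else 0) +
        (if h : j < k then if 1 ≤ kuhnVertex x τ j ⟨j, h⟩ then 1 else 0 else 0)) =
      if τ = 1 ∧ x = 0 then 1 else 0 := by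
    intro τ x
    split_ifs with h
    · obtain ⟨rfl, rfl⟩ := h
      refine Finset.prod_eq_one fun j hj => ?_
      simp [Finset.mem_range.1 hj, kuhnVertex]
    · by_contra hne
      rw [Finset.prod_eq_zero_iff, not_exists] at hne
      have hj : ∀ j : Fin k, τ j = j ∧ x j = 0 := by
        intro j
        have := hne j
        simp only [Finset.mem_range, j.2, true_and, dif_pos, Fin.eta] at this
        constructor
        · by_contra hτ
          have hτ' : (τ j : ℕ) ≠ j := fun h => hτ (Fin.ext h)
          have heq : kuhnVertex x τ (j + 1) j = kuhnVertex x τ j j := by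
            unfold kuhnVertex
            congr 2
            simp only [eq_iff_iff]; omega
          refine this ?_
          simp only [heq]
          exact CharTwo.add_self_eq_zero _
        · by_contra hx
          have h1 := le_kuhnVertex x τ (j + 1) j
          have h2 := kuhnVertex_le x τ (j + 1) j
          have h3 := le_kuhnVertex x τ j j
          have h4 := kuhnVertex_le x τ j j
          refine this ?_
          rcases lt_or_gt_of_ne hx with hx | hx
          · rw [if_neg (by omega), if_neg (by omega), add_zero]
          · rw [if_pos (by omega), if_pos (by omega)]
            exact CharTwo.add_self_eq_zero _
      exact h ⟨Equiv.ext fun j => (hj j).1, funext fun j => (hj j).2⟩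
  unfold kuhnSum
  simp only [key]
  rw [Finset.sum_eq_single 1]
  · rw [finsum_eq_single _ 0]
    · simp
    · intro x hx; simp [hx]
  · intro τ _ hτ
    simp [hτ]
  · simp

/-- A discrete form of the Poincaré–Miranda theorem: if each of `k` functions on the lattice `ℤ ^ k`
separates the corresponding pair of opposite half spaces, then none of them is constant on some
common unit cube. -/
theorem exists_unit_cube_forall_not_const {N : ℤ} (hN : 1 ≤ N)
    {a : Fin k → (Fin k → ℤ) → Prop} (h0 : ∀ j x, x j ≤ 0 → ¬ a j x)
    (h1 : ∀ j x, N ≤ x j → a j x) :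
    ∃ x : Fin k → ℤ, ∀ j, ∃ u v : Fin k → ℤ, (∀ i, x i ≤ u i ∧ u i ≤ x i + 1) ∧
      (∀ i, x i ≤ v i ∧ v i ≤ x i + 1) ∧ a j u ∧ ¬ a j v := by
  classical
  set A : ℕ → (Fin k → ℤ) → ZMod 2 :=
    fun j x => if h : j < k then if a ⟨j, h⟩ x then 1 else 0 else 0 with hA
  have hsum : kuhnSum k A = 1 := by
    rw [← kuhnSum_step (k := k)]
    refine kuhnSum_eq (N := N) (fun j x => ⟨fun hx => ?_, fun hx => ?_⟩)
      (fun j x => ⟨fun hx => ?_, fun hx => ?_⟩)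
    · simp [hA, h0 j x hx]
    · simp [hA, h1 j x hx]
    · simp [show ¬ 1 ≤ x j by omega]
    · simp [show 1 ≤ x j by omega]
  obtain ⟨τ, -, hτ⟩ := Finset.exists_ne_zero_of_sum_ne_zero (hsum.trans_ne one_ne_zero)
  obtain ⟨x, hx⟩ : ∃ x, ∏ j ∈ Finset.range k,
      (A j (kuhnVertex x τ (j + 1)) + A j (kuhnVertex x τ j)) ≠ 0 := by
    by_contra! hzero
    exact hτ ((finsum_congr hzero).trans finsum_zero)
  refine ⟨x, fun j => ?_⟩
  have hj := Finset.prod_ne_zero_iff.1 hx j (Finset.mem_range.2 j.2)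
  have hu := fun m i => And.intro (le_kuhnVertex x τ m i) (kuhnVertex_le x τ m i)
  simp only [hA, j.2, dif_pos, Fin.eta] at hj
  by_cases hp : a j (kuhnVertex x τ (j + 1)) <;> by_cases hq : a j (kuhnVertex x τ j)
  · simp [hp, hq, CharTwo.add_self_eq_zero] at hj
  · exact ⟨_, _, hu _, hu _, hp, hq⟩
  · exact ⟨_, _, hu _, hu _, hq, hp⟩
  · simp [hp, hq] at hj

end Kuhn

/-! ### The Poincaré–Miranda theorem and maps with low-dimensional image. -/

section PoincareMiranda

variable {k : ℕ}

open Filter Topology Set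

/-- The **Poincaré–Miranda theorem**. -/
theorem exists_eq_zero_of_forall_faces {h : (Fin k → ℝ) → Fin k → ℝ} (hc : Continuous h)
    (h0 : ∀ x ∈ Icc (0 : Fin k → ℝ) 1, ∀ j, x j = 0 → h x j < 0)
    (h1 : ∀ x ∈ Icc (0 : Fin k → ℝ) 1, ∀ j, x j = 1 → 0 < h x j) :
    ∃ x ∈ Icc (0 : Fin k → ℝ) 1, h x = 0 := by
  by_contra! hne
  have hcomp : IsCompact (Icc (0 : Fin k → ℝ) 1) := isCompact_Icc
  obtain ⟨x₀, hx₀, hmin⟩ := hcomp.exists_isMinOn ⟨0, by simp⟩ hc.norm.continuousOn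
  have hδ : 0 < ‖h x₀‖ := norm_pos_iff.2 (hne x₀ hx₀)
  obtain ⟨η, hη, hu⟩ := Metric.uniformContinuousOn_iff.1
    (hcomp.uniformContinuousOn_of_continuous hc.continuousOn) _ hδ
  obtain ⟨M, hM⟩ := exists_nat_one_div_lt hη
  have hN : (0 : ℝ) < M + 1 := by positivity
  -- The grid of mesh `1 / (M + 1)`, clamped to the cube so that the sign conditions hold on whole
  -- half spaces.
  set q : (Fin k → ℤ) → Fin k → ℝ := fun x i => max 0 (min 1 (x i / (M + 1))) with hq
  have hmem : ∀ x, q x ∈ Icc (0 : Fin k → ℝ) 1 := fun x =>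
    ⟨fun i => le_max_left _ _, fun i => max_le zero_le_one (min_le_left _ _)⟩
  have hdist : ∀ x u : Fin k → ℤ, (∀ i, x i ≤ u i ∧ u i ≤ x i + 1) → dist (q u) (q x) < η := by
    intro x u hxu
    refine ((dist_pi_le_iff (by positivity)).2 fun i => ?_).trans_lt hM
    have h1 : (x i : ℝ) ≤ u i := by exact_mod_cast (hxu i).1
    have h2 : (u i : ℝ) ≤ x i + 1 := by exact_mod_cast (hxu i).2
    have h3 : |(u i : ℝ) / (M + 1) - x i / (M + 1)| ≤ 1 / (M + 1) := by
      rw [← sub_div, abs_div, abs_of_pos hN]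
      gcongr
      rw [abs_le]; constructor <;> linarith
    refine le_trans ?_ h3
    rw [Real.dist_eq]
    refine (abs_max_sub_max_le_max _ _ _ _).trans ?_
    rw [sub_self, abs_zero, max_eq_right (abs_nonneg _)]
    refine (abs_min_sub_min_le_max _ _ _ _).trans ?_
    rw [sub_self, abs_zero, max_eq_right (abs_nonneg _)]
  obtain ⟨x, hx⟩ := exists_unit_cube_forall_not_const (N := M + 1) (by omega)
    (a := fun j x => 0 < h (q x) j)
    (fun j x hx => not_lt.2 (h0 _ (hmem x) j (by
      have : (x j : ℝ) / (M + 1) ≤ 0 := div_nonpos_of_nonpos_of_nonneg (by exact_mod_cast hx) hN.le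
      simp only [hq]
      rw [max_eq_left ((min_le_right _ _).trans this)])).le)
    (fun j x hx => h1 _ (hmem x) j (by
      have : 1 ≤ (x j : ℝ) / (M + 1) := by
        rw [one_le_div hN]; exact_mod_cast hx
      simp only [hq]
      rw [min_eq_left this, max_eq_right zero_le_one]))
  -- Each coordinate of `h` changes sign near `q x`, within oscillation `‖h x₀‖`; so `‖h (q x)‖` is
  -- below the minimum.
  refine absurd (hmin (hmem x)) (not_le.2 ((pi_norm_lt_iff hδ).2 fun j => ?_))
  obtain ⟨u, v, hu', hv', hpos, hneg⟩ := hx j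
  have h3 := (dist_le_pi_dist _ _ j).trans_lt (hu _ (hmem u) _ (hmem x) (hdist x u hu'))
  have h4 := (dist_le_pi_dist _ _ j).trans_lt (hu _ (hmem v) _ (hmem x) (hdist x v hv'))
  rw [Real.dist_eq, abs_lt] at h3 h4
  rw [Real.norm_eq_abs, abs_lt]
  constructor <;> linarith

/-- A continuous map on the cube `[0, 1] ^ k` whose image has dimension less than `k` identifies two
points on opposite faces. -/
theorem exists_opposite_faces_eq_of_dimH_lt {W : Type*} [MetricSpace W] {b : (Fin k → ℝ) → W}
    (hb : Continuous b) (hdim : dimH (b '' Icc 0 1) < k) :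
    ∃ j, ∃ x ∈ Icc (0 : Fin k → ℝ) 1, ∃ y ∈ Icc (0 : Fin k → ℝ) 1,
      x j = 0 ∧ y j = 1 ∧ b x = b y := by
  by_contra! hne
  set F : ℝ → Fin k → Set (Fin k → ℝ) := fun r j => Icc 0 1 ∩ {x | x j = r} with hF
  have hFc : ∀ r j, IsCompact (F r j) := fun r j =>
    isCompact_Icc.inter_right (isClosed_eq (continuous_apply j) continuous_const)
  have hF0 : ∀ j, (F 0 j).Nonempty := fun j => ⟨0, by simp [hF]⟩
  have hF1 : ∀ j, (F 1 j).Nonempty := fun j => ⟨1, by simp [hF]⟩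
  set g : W → Fin k → ℝ := fun y j =>
    Metric.infDist y (b '' F 0 j) - Metric.infDist y (b '' F 1 j) with hg
  have hgL : LipschitzWith (1 + 1) g := by
    refine LipschitzWith.of_dist_le_mul fun y z => ?_
    refine (dist_pi_le_iff (by positivity)).2 fun j => ?_
    exact ((Metric.lipschitz_infDist_pt (b '' F 0 j)).sub
      (Metric.lipschitz_infDist_pt (b '' F 1 j))).dist_le_mul y z
  have hneg : ∀ j, ∀ x ∈ F 0 j, g (b x) j < 0 := by
    intro j x hx
    have h1 : Metric.infDist (b x) (b '' F 0 j) = 0 :=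
      Metric.infDist_zero_of_mem (mem_image_of_mem b hx)
    have h2 : 0 < Metric.infDist (b x) (b '' F 1 j) := by
      rw [← ((hFc 1 j).image hb).isClosed.notMem_iff_infDist_pos ((hF1 j).image b)]
      rintro ⟨y, hy, hyx⟩
      exact hne j x hx.1 y hy.1 hx.2 hy.2 hyx.symm
    simp only [hg]; linarith
  have hpos : ∀ j, ∀ x ∈ F 1 j, 0 < g (b x) j := by
    intro j x hx
    have h1 : Metric.infDist (b x) (b '' F 1 j) = 0 :=
      Metric.infDist_zero_of_mem (mem_image_of_mem b hx)
    have h2 : 0 < Metric.infDist (b x) (b '' F 0 j) := by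
      rw [← ((hFc 0 j).image hb).isClosed.notMem_iff_infDist_pos ((hF0 j).image b)]
      rintro ⟨y, hy, hyx⟩
      exact hne j y hy.1 x hx.1 hy.2 hx.2 hyx
    simp only [hg]; linarith
  have hgb : Continuous fun x => g (b x) := hgL.continuous.comp hb
  have hgbj : ∀ j, Continuous fun x => g (b x) j := fun j => (continuous_apply j).comp hgb
  -- By compactness the strict signs on the faces survive a small shift `c`, which can then be
  -- chosen outside the image of `g`.
  have hev : ∀ᶠ c in 𝓝 (0 : Fin k → ℝ), ∀ j,
      (∀ x ∈ F 0 j, g (b x) j < c j) ∧ ∀ x ∈ F 1 j, c j < g (b x) j := by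
    refine eventually_all.2 fun j => Filter.Eventually.and ?_ ?_
    · obtain ⟨z, hz, hmax⟩ := (hFc 0 j).exists_isMaxOn (hF0 j) (hgbj j).continuousOn
      have : ∀ᶠ c in 𝓝 (0 : Fin k → ℝ), g (b z) j < c j :=
        (continuous_apply j).continuousAt.eventually_const_lt (hneg j z hz)
      filter_upwards [this] with c hc x hx
      exact (hmax hx).trans_lt hc
    · obtain ⟨z, hz, hmin⟩ := (hFc 1 j).exists_isMinOn (hF1 j) (hgbj j).continuousOn
      have : ∀ᶠ c in 𝓝 (0 : Fin k → ℝ), c j < g (b z) j :=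
        (continuous_apply j).continuousAt.eventually_lt_const (hpos j z hz)
      filter_upwards [this] with c hc x hx
      exact lt_of_lt_of_le hc (hmin hx)
  have hdense : Dense (g '' (b '' Icc 0 1))ᶜ := by
    refine dense_compl_of_dimH_lt_finrank ((hgL.dimH_image_le _).trans_lt ?_)
    simpa using hdim
  obtain ⟨c, hcmem, hc⟩ := hdense.inter_nhds_nonempty hev
  obtain ⟨x, hx, hxc⟩ := exists_eq_zero_of_forall_faces (h := fun x => g (b x) - c)
    (hgb.sub continuous_const)
    (fun x hx j hj => sub_neg.2 ((hc j).1 x ⟨hx, hj⟩))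
    (fun x hx j hj => sub_pos.2 ((hc j).2 x ⟨hx, hj⟩))
  exact hcmem ⟨b x, mem_image_of_mem b hx, sub_eq_zero.1 hxc⟩

end PoincareMiranda

/-! ### Barycentric coordinates and compact sets in polyhedra. -/

namespace Geometry.SimplicialComplex

open Set Topology

section Weights

variable {E : Type*}

open scoped Classical in
/-- The extension by zero of a weight function on a finite set. -/
noncomputable def extendWeights (s : Finset E) (w : s → ℝ) (v : E) : ℝ :=
  if h : v ∈ s then w ⟨v, h⟩ else 0

lemma extendWeights_of_notMem {s : Finset E} (w : s → ℝ) {v : E} (h : v ∉ s) :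
    extendWeights s w v = 0 := dif_neg h

lemma extendWeights_coe {s : Finset E} (w : s → ℝ) (v : s) : extendWeights s w v = w v :=
  dif_pos v.2

lemma sum_extendWeights (s : Finset E) (w : stdSimplex ℝ s) :
    ∑ v ∈ s, extendWeights s w.1 v = 1 := by
  rw [← Finset.sum_coe_sort]
  simpa only [extendWeights_coe] using w.2.2

end Weights

variable {E : Type*} [AddCommGroup E] [Module ℝ E] {K : SimplicialComplex ℝ E}

lemma sum_extendWeights_smul (s : K.faces) (w : stdSimplex ℝ (s : Finset E)) :
    ∑ v ∈ (s : Finset E), extendWeights s w.1 v • v = (K.simplexMap s w).1 := by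
  rw [← Finset.sum_coe_sort]
  simp only [extendWeights_coe]
  rfl

lemma exists_simplexMap_eq (y : K.Polyhedron) :
    ∃ (s : K.faces) (w : stdSimplex ℝ (s : Finset E)), K.simplexMap s w = y := by
  obtain ⟨x, hx⟩ := y
  obtain ⟨s, hs, hxs⟩ := mem_space_iff.1 hx
  obtain ⟨w, h0, h1, rfl⟩ := Finset.mem_convexHull'.1 hxs
  refine ⟨⟨s, hs⟩, ⟨fun v => w v, fun v => h0 v v.2, ?_⟩, Subtype.ext ?_⟩
  · rw [← h1]; exact Finset.sum_coe_sort s w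
  · exact Finset.sum_coe_sort s fun v => w v • v

lemma eq_of_weights_subset {s t : Finset E} (hs : s ∈ K.faces) (hts : t ⊆ s) {w u : E → ℝ}
    (hw : ∀ v ∉ s, w v = 0) (hu : ∀ v ∉ t, u v = 0) (hw1 : ∑ v ∈ s, w v = 1)
    (hu1 : ∑ v ∈ t, u v = 1) (h : ∑ v ∈ s, w v • v = ∑ v ∈ t, u v • v) : w = u := by
  have hut : ∑ v ∈ s, u v = 1 := by
    rw [← hu1]; exact (Finset.sum_subset hts fun v _ hv => hu v hv).symm
  have hus : ∑ v ∈ s, u v • v = ∑ v ∈ t, u v • v :=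
    (Finset.sum_subset hts fun v _ hv => by rw [hu v hv, zero_smul]).symm
  have key := (K.indep hs).eq_zero_of_sum_eq_zero_subtype (w := fun v => w v - u v)
    (by rw [Finset.sum_sub_distrib, hw1, hut, sub_self])
    (by simp only [sub_smul, Finset.sum_sub_distrib, h, hus, sub_self])
  funext v
  by_cases hv : v ∈ s
  · exact sub_eq_zero.1 (key v hv)
  · rw [hw v hv, hu v fun h => hv (hts h)]

/-- A point of two simplices lies in the hull of their common vertices; affine independence in each
simplex identifies both weights with those on the common face. -/
lemma extendWeights_eq_of_simplexMap_eq {s t : K.faces} {w : stdSimplex ℝ (s : Finset E)}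
    {u : stdSimplex ℝ (t : Finset E)} (h : K.simplexMap s w = K.simplexMap t u) :
    extendWeights (s : Finset E) w.1 = extendWeights (t : Finset E) u.1 := by
  classical
  have hmem : ∀ (r : K.faces) (z : stdSimplex ℝ (r : Finset E)),
      (K.simplexMap r z).1 ∈ convexHull ℝ ((r : Finset E) : Set E) := fun r z =>
    (convex_convexHull ℝ ((r : Finset E) : Set E)).sum_mem (fun v _ => z.2.1 v) z.2.2
      (fun v _ => subset_convexHull ℝ _ v.2)
  have hx : (K.simplexMap s w).1 ∈
      convexHull ℝ (((s : Finset E) ∩ (t : Finset E) : Finset E) : Set E) := by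
    rw [Finset.coe_inter]
    exact K.inter_subset_convexHull s.2 t.2 ⟨hmem s w, h ▸ hmem t u⟩
  obtain ⟨z, -, hz1, hz⟩ := Finset.mem_convexHull'.1 hx
  set r := (s : Finset E) ∩ (t : Finset E) with hr
  have hz' : ∀ v ∉ r, (if v ∈ r then z v else 0) = 0 := fun v hv => if_neg hv
  have hz1' : ∑ v ∈ r, (if v ∈ r then z v else 0) = 1 := by
    rw [← hz1]; exact Finset.sum_congr rfl fun v hv => if_pos hv
  have hz2 : ∑ v ∈ r, (if v ∈ r then z v else 0) • v = (K.simplexMap s w).1 := by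
    rw [← hz]; exact Finset.sum_congr rfl fun v hv => by rw [if_pos hv]
  exact (eq_of_weights_subset s.2 Finset.inter_subset_left
      (fun v hv => extendWeights_of_notMem w.1 hv) hz' (sum_extendWeights _ w) hz1'
      (by rw [sum_extendWeights_smul, hz2])).trans
    (eq_of_weights_subset t.2 Finset.inter_subset_right
      (fun v hv => extendWeights_of_notMem u.1 hv) hz' (sum_extendWeights _ u) hz1'
      (by rw [sum_extendWeights_smul, hz2, h])).symm

lemma simplexMap_injective (s : K.faces) : Function.Injective (K.simplexMap s) := by
  intro w u h
  refine Subtype.ext (funext fun v => ?_)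
  have := congrFun (extendWeights_eq_of_simplexMap_eq h) v
  rwa [extendWeights_coe, extendWeights_coe] at this

/-- A face containing a given point of the polyhedron. -/
noncomputable def someFace (y : K.Polyhedron) : K.faces := (exists_simplexMap_eq y).choose

/-- The barycentric coordinates of a point of the polyhedron. -/
noncomputable def barycentric (y : K.Polyhedron) : E → ℝ :=
  extendWeights (someFace y : Finset E) (exists_simplexMap_eq y).choose_spec.choose.1

lemma barycentric_simplexMap (s : K.faces) (w : stdSimplex ℝ (s : Finset E)) :
    barycentric (K.simplexMap s w) = extendWeights (s : Finset E) w.1 :=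
  extendWeights_eq_of_simplexMap_eq
    (exists_simplexMap_eq (K.simplexMap s w)).choose_spec.choose_spec

lemma continuous_barycentric (v : E) : Continuous fun y : K.Polyhedron => barycentric y v := by
  refine continuous_iSup_dom.2 fun s => continuous_coinduced_dom.2 ?_
  have : (fun y : K.Polyhedron => barycentric y v) ∘ K.simplexMap s =
      fun w => extendWeights (s : Finset E) w.1 v := by
    funext w
    exact congrFun (barycentric_simplexMap s w) v
  rw [this]
  unfold extendWeights
  split_ifs with h
  · exact (continuous_apply _).comp continuous_subtype_val
  · exact continuous_const

/-- The vertex set of the simplex containing a given point in its relative interior. -/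
noncomputable def carrier (y : K.Polyhedron) : Finset E :=
  (someFace y : Finset E).filter fun v => barycentric y v ≠ 0

lemma mem_carrier {y : K.Polyhedron} {v : E} : v ∈ carrier y ↔ barycentric y v ≠ 0 := by
  refine ⟨fun h => (Finset.mem_filter.1 h).2, fun h => Finset.mem_filter.2 ⟨?_, h⟩⟩
  by_contra hv
  exact h (extendWeights_of_notMem _ hv)

lemma carrier_subset_someFace (y : K.Polyhedron) : carrier y ⊆ (someFace y : Finset E) :=
  Finset.filter_subset _ _

lemma sum_barycentric (y : K.Polyhedron) : ∑ v ∈ carrier y, barycentric y v = 1 := by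
  rw [← sum_extendWeights _ (exists_simplexMap_eq y).choose_spec.choose]
  exact Finset.sum_filter_ne_zero _

lemma sum_barycentric_smul (y : K.Polyhedron) : ∑ v ∈ carrier y, barycentric y v • v = y.1 := by
  conv_rhs => rw [← (exists_simplexMap_eq y).choose_spec.choose_spec, ← sum_extendWeights_smul]
  refine Finset.sum_subset (carrier_subset_someFace y) fun v _ hv => ?_
  rw [not_not.1 (mt mem_carrier.2 hv), zero_smul]

/-- Pick one point of `C` per carrier. A closed simplex contains only finitely many of them, so in
the weak topology every set of such points is closed, and an infinite one would have no accumulation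
point. -/
lemma finite_image_carrier {C : Set K.Polyhedron} (hC : IsCompact C) : (carrier '' C).Finite := by
  obtain ⟨P, hPC, hP⟩ := (Set.surjOn_image carrier C).exists_bijOn_subset
  rw [← hP.image_eq]
  refine Set.Finite.image _ ?_
  by_contra hinf
  obtain ⟨x, -, hx⟩ := Set.Infinite.exists_accPt_of_subset_isCompact hinf hC hPC
  have hclosed : IsClosed (P \ {x}) := by
    refine isClosed_iSup_iff.2 fun s => isClosed_coinduced.2 (Set.Finite.isClosed ?_)
    refine Set.Finite.of_injOn (f := fun w => carrier (K.simplexMap s w))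
      (t := ((s : Finset E).powerset : Set (Finset E))) ?_ ?_ (Finset.finite_toSet _)
    · intro w _
      simp only [Finset.coe_powerset, Set.mem_preimage, Set.mem_powerset_iff, Finset.coe_subset]
      intro v hv
      rw [mem_carrier, barycentric_simplexMap] at hv
      by_contra hvs
      exact hv (extendWeights_of_notMem _ hvs)
    · intro w hw u hu h
      exact simplexMap_injective s (hP.injOn hw.1 hu.1 h)
  obtain ⟨y, ⟨hy, hyP⟩, hyx⟩ := accPt_iff_nhds.1 hx _
    (hclosed.isOpen_compl.mem_nhds fun h => h.2 rfl)
  exact hy ⟨hyP, hyx⟩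

/-- The weight at `v₀` is determined by the others, which leaves at most `d` free coordinates. -/
lemma dimH_weights_le {V : Type*} [Fintype V] (t : Set V) {v₀ : V} (hv₀ : v₀ ∈ t) {d : ℕ}
    (ht : t.ncard ≤ d + 1) :
    dimH {w : V → ℝ | (∀ v ∉ t, w v = 0) ∧ ∑ v, w v = 1} ≤ d := by
  classical
  set p : V → Prop := fun v => v ∈ t ∧ v ≠ v₀ with hp
  set φ : ({v // p v} → ℝ) → V → ℝ := fun u v =>
    if h : p v then u ⟨v, h⟩ else if v = v₀ then 1 - ∑ i, u i else 0 with hφ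
  have hsub : {w : V → ℝ | (∀ v ∉ t, w v = 0) ∧ ∑ v, w v = 1} ⊆ range φ := by
    rintro w ⟨hw, hw1⟩
    refine ⟨fun v => w v, funext fun v => ?_⟩
    simp only [hφ]
    split_ifs with h1 h2
    · rfl
    · subst h2
      rw [sub_eq_iff_eq_add, ← hw1,
        ← Finset.sum_subtype (Finset.univ.filter p) (by simp) w,
        ← Finset.sum_insert (by simp [hp])]
      refine (Finset.sum_subset (Finset.subset_univ _) fun i _ hi => hw i fun hit => hi ?_).symm
      by_cases hiv : i = v
      · simp [hiv]
      · simp [hp, hit, hiv]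
    · exact (hw v fun hvt => h1 ⟨hvt, h2⟩).symm
  have hcont : ContDiff ℝ 1 φ := by
    refine contDiff_pi.2 fun v => ?_
    simp only [hφ]
    split_ifs with h1 h2
    · exact contDiff_apply ℝ ℝ _
    · exact contDiff_const.sub (ContDiff.sum fun i _ => contDiff_apply ℝ ℝ i)
    · exact contDiff_const
  refine (dimH_mono hsub).trans (hcont.dimH_range_le.trans ?_)
  rw [Module.finrank_fintype_fun_eq_card]
  have hcard : Fintype.card {v // p v} + 1 ≤ d + 1 := by
    refine le_trans (le_of_eq ?_) ht
    rw [← Set.ncard_sdiff_singleton_add_one hv₀, ← Nat.card_eq_fintype_card]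
    rfl
  exact_mod_cast Nat.le_of_succ_le_succ hcard

/-- A compact space mapped to a `d`-dimensional polyhedron can be mapped with the same fibres to a
subset of dimension at most `d` of a finite-dimensional real vector space. -/
theorem exists_continuous_dimH_range_le {X : Type*} [TopologicalSpace X] [CompactSpace X]
    {f : X → K.Polyhedron} (hf : Continuous f) {d : ℕ} (hd : ∀ s ∈ K.faces, s.card ≤ d + 1) :
    ∃ (V : Finset E) (b : X → V → ℝ), Continuous b ∧ (∀ x y, b x = b y → f x = f y) ∧
      dimH (range b) ≤ d := by
  classical
  have hfin := finite_image_carrier (isCompact_range hf)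
  set V : Finset E := hfin.toFinset.biUnion id with hV
  have hVsub : ∀ x, carrier (f x) ⊆ V := fun x =>
    Finset.subset_biUnion_of_mem id (hfin.mem_toFinset.2 ⟨_, mem_range_self x, rfl⟩)
  refine ⟨V, fun x v => barycentric (f x) v,
    continuous_pi fun v => (continuous_barycentric (v : E)).comp hf, fun x y h => ?_, ?_⟩
  · have hx : ∀ x, ∑ v : V, barycentric (f x) v • (v : E) = (f x).1 := by
      intro x
      rw [Finset.sum_coe_sort V fun v => barycentric (f x) v • v, ← sum_barycentric_smul (f x)]
      refine (Finset.sum_subset (hVsub x) fun v _ hv => ?_).symm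
      rw [not_not.1 (mt mem_carrier.2 hv), zero_smul]
    refine Subtype.ext ?_
    rw [← hx x, ← hx y]
    exact Finset.sum_congr rfl fun v _ => congrArg (· • (v : E)) (congrFun h v)
  · have hsub : range (fun x (v : V) => barycentric (f x) v) ⊆ ⋃ t ∈ carrier '' range f,
        {w : V → ℝ | (∀ v, v ∉ {v : V | (v : E) ∈ t} → w v = 0) ∧ ∑ v, w v = 1} := by
      rintro _ ⟨x, rfl⟩
      refine mem_biUnion ⟨_, mem_range_self x, rfl⟩ ⟨fun v hv => ?_, ?_⟩
      · exact not_not.1 (mt mem_carrier.2 hv)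
      · rw [Finset.sum_coe_sort V fun v => barycentric (f x) v, ← sum_barycentric (f x)]
        exact (Finset.sum_subset (hVsub x) fun v _ hv => not_not.1 (mt mem_carrier.2 hv)).symm
    refine (dimH_mono hsub).trans ?_
    rw [dimH_bUnion hfin.countable]
    refine iSup₂_le ?_
    rintro _ ⟨_, ⟨x, rfl⟩, rfl⟩
    obtain ⟨v, hv⟩ : (carrier (f x)).Nonempty := by
      rw [Finset.nonempty_iff_ne_empty]
      intro h
      have := sum_barycentric (f x)
      rw [h] at this
      simp at this
    refine dimH_weights_le {u : V | (u : E) ∈ carrier (f x)} (v₀ := ⟨v, hVsub x hv⟩) hv ?_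
    refine le_trans ?_ ((Finset.card_le_card (carrier_subset_someFace (f x))).trans
      (hd _ (someFace (f x)).2))
    rw [← Set.ncard_coe_finset]
    exact Set.ncard_le_ncard_of_injOn (fun u : V => (u : E)) (fun u hu => hu)
      Subtype.val_injective.injOn (Finset.finite_toSet _)

end Geometry.SimplicialComplex

/-! ### Upper bound: soft thresholding into a skeleton. -/

section UpperBound

open Geometry Set Topology

/-- The `k`-skeleton of the simplex with vertex set `I`. -/
noncomputable def simplexSkeleton (I : Type*) [DecidableEq I] (k : ℕ) :
    SimplicialComplex ℝ (I →₀ ℝ) :=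
  SimplicialComplex.onFinsupp
    { faces := {s | s.Nonempty ∧ s.card ≤ k + 1}
      isRelLowerSet_faces := fun _ hs =>
        ⟨hs.1, fun _ hts ht => ⟨ht, (Finset.card_le_card hts).trans hs.2⟩⟩ }

lemma mem_faces_simplexSkeleton {I : Type*} [DecidableEq I] {k : ℕ} {s : Finset I}
    (hs : s.Nonempty) (hk : s.card ≤ k + 1) :
    s.image (fun i => Finsupp.single i (1 : ℝ)) ∈ (simplexSkeleton I k).faces :=
  ⟨s, ⟨hs, hk⟩, rfl⟩

lemma dimension_simplexSkeleton_le (I : Type*) [DecidableEq I] (k : ℕ) :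
    (simplexSkeleton I k).dimension ≤ k := by
  refine iSup₂_le ?_
  rintro _ ⟨s, ⟨_, hs⟩, rfl⟩
  have : (s.image fun i => Finsupp.single i (1 : ℝ)).card ≤ k + 1 := Finset.card_image_le.trans hs
  exact_mod_cast (by omega : (s.image fun i => Finsupp.single i (1 : ℝ)).card - 1 ≤ k)

lemma continuous_simplexMap {E : Type*} [AddCommGroup E] [Module ℝ E] {K : SimplicialComplex ℝ E}
    (s : K.faces) : Continuous (K.simplexMap s) :=
  continuous_iSup_rng (i := s) continuous_coinduced_rng

lemma exists_simplexMap_skeleton_eq {I : Type*} [Fintype I] [DecidableEq I] {k : ℕ} {s : Finset I}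
    (hs : s.Nonempty) (hk : s.card ≤ k + 1) :
    ∃ g : {w : I → ℝ | w ∈ stdSimplex ℝ I ∧ ∀ i ∉ s, w i = 0} → (simplexSkeleton I k).Polyhedron,
      Continuous g ∧ ∀ w, (g w).1 = Finsupp.equivFunOnFinite.symm w.1 := by
  have hinj : Function.Injective fun i : I => Finsupp.single i (1 : ℝ) :=
    Finsupp.single_left_injective one_ne_zero
  have hcoord : ∀ (w : I → ℝ) (i : I), ∑ j, w j * Finsupp.single i (1 : ℝ) j = w i := by
    intro w i
    simp [Finsupp.single_apply]
  refine ⟨fun w => (simplexSkeleton I k).simplexMap ⟨_, mem_faces_simplexSkeleton hs hk⟩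
    ⟨fun v => ∑ j, w.1 j * v.1 j, ?_, ?_⟩, ?_, ?_⟩
  · rintro ⟨v, hv⟩
    obtain ⟨i, _, rfl⟩ := Finset.mem_image.1 hv
    simp only [hcoord]
    exact w.2.1.1 i
  · rw [Finset.sum_coe_sort _ fun v : I →₀ ℝ => ∑ j, w.1 j * v j,
      Finset.sum_image hinj.injOn]
    simp only [hcoord]
    rw [← w.2.1.2]
    exact Finset.sum_subset (Finset.subset_univ s) fun i _ hi => w.2.2 i hi
  · refine (continuous_simplexMap _).comp (Continuous.subtype_mk (continuous_pi fun v => ?_) _)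
    exact continuous_finsetSum _ fun j _ =>
      ((continuous_apply j).comp continuous_subtype_val).mul continuous_const
  · intro w
    change ∑ v : ((s.image fun i => Finsupp.single i (1 : ℝ) : Finset (I →₀ ℝ))),
      (∑ j, w.1 j * v.1 j) • v.1 = _
    rw [Finset.sum_coe_sort _ fun v : I →₀ ℝ => (∑ j, w.1 j * v j) • v,
      Finset.sum_image hinj.injOn]
    simp only [hcoord]
    rw [Finset.sum_subset (Finset.subset_univ s) fun i _ hi => by rw [w.2.2 i hi, zero_smul]]
    ext i
    simp [Finsupp.finsetSum_apply, Finsupp.single_apply]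

/-- Since `I` is finite, continuity for the weak topology can be glued from the finitely many closed
sets on which the support lies in a given face. -/
lemma exists_continuous_to_skeleton {X I : Type*} [TopologicalSpace X] [Fintype I] [DecidableEq I]
    {k : ℕ} {w : X → I → ℝ} (hw : Continuous w) (hmem : ∀ x, w x ∈ stdSimplex ℝ I)
    (hcard : ∀ x, ∃ s : Finset I, s.card ≤ k + 1 ∧ ∀ i ∉ s, w x i = 0) :
    ∃ f : X → (simplexSkeleton I k).Polyhedron, Continuous f ∧
      ∀ x, (f x).1 = Finsupp.equivFunOnFinite.symm (w x) := by
  have hne : ∀ x, ∀ s : Finset I, (∀ i ∉ s, w x i = 0) → s.Nonempty := by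
    intro x s hs
    rw [Finset.nonempty_iff_ne_empty]
    rintro rfl
    have := (hmem x).2
    rw [Finset.sum_eq_zero fun i _ => hs i (by simp)] at this
    exact zero_ne_one this
  set A : {s : Finset I // s.Nonempty ∧ s.card ≤ k + 1} → Set X :=
    fun s => {x | ∀ i ∉ s.1, w x i = 0} with hA
  have hcov : ⋃ s, A s = univ := by
    refine eq_univ_of_forall fun x => ?_
    obtain ⟨s, hs, hsx⟩ := hcard x
    exact mem_iUnion.2 ⟨⟨s, hne x s hsx, hs⟩, hsx⟩
  choose g hg hgval using fun s : {s : Finset I // s.Nonempty ∧ s.card ≤ k + 1} =>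
    exists_simplexMap_skeleton_eq s.2.1 s.2.2
  have hspace : ∀ x,
      (Finsupp.equivFunOnFinite.symm (w x) : I →₀ ℝ) ∈ (simplexSkeleton I k).space := by
    intro x
    obtain ⟨s, hs⟩ := mem_iUnion.1 (hcov.symm ▸ mem_univ x)
    rw [← hgval s ⟨w x, hmem x, hs⟩]
    exact (g s _).2
  let f : X → (simplexSkeleton I k).Polyhedron := fun x => ⟨_, hspace x⟩
  refine ⟨f, ?_, fun x => rfl⟩
  refine (locallyFinite_of_finite A).continuous hcov (fun s => ?_) fun s => ?_
  · simp only [hA, ofPred_forall]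
    exact isClosed_iInter fun i => isClosed_iInter fun _ =>
      isClosed_eq ((continuous_apply i).comp hw) continuous_const
  · refine continuousOn_iff_continuous_domRestrict.2 ?_
    have : Continuous fun x : A s => g s ⟨w x, hmem x, x.2⟩ :=
      (hg s).comp (Continuous.subtype_mk (hw.comp continuous_subtype_val) _)
    refine this.congr fun x => Subtype.ext ?_
    exact hgval s _

/-- A space has `ε`-width dimension at most `k` if it has a continuous family of barycentric
coordinates, at most `k + 1` of which are nonzero at any point, with fibres of diameter at most
`ε`. -/
lemma wdim_le_of_barycentric {X I : Type u} [MetricSpace X] [Fintype I] {k : ℕ} {ε : ℝ}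
    {w : X → I → ℝ} (hw : Continuous w) (hmem : ∀ x, w x ∈ stdSimplex ℝ I)
    (hcard : ∀ x, ∃ s : Finset I, s.card ≤ k + 1 ∧ ∀ i ∉ s, w x i = 0)
    (hfib : ∀ x y, w x = w y → dist x y ≤ ε) : wdim ε X ≤ k := by
  classical
  obtain ⟨f, hf, hfval⟩ := exists_continuous_to_skeleton hw hmem hcard
  suffices h : wdim ε X ≤ (simplexSkeleton I k).dimension from
    h.trans (dimension_simplexSkeleton_le I k)
  refine sInf_le ⟨I →₀ ℝ, _, _, simplexSkeleton I k, f, ⟨hf, fun y => ?_⟩, rfl⟩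
  refine Metric.ediam_le fun a ha b hb => ?_
  rw [edist_dist]
  refine ENNReal.ofReal_le_ofReal (hfib a b (Finsupp.equivFunOnFinite.symm.injective ?_))
  rw [← hfval, ← hfval, show f a = f b from Eq.trans ha (Eq.symm hb)]

/-- A continuous choice of the `k + 1`-st largest absolute value of the coordinates. -/
lemma exists_continuous_order_statistic (n k : ℕ) : ∃ T : (Fin n → ℝ) → ℝ, Continuous T ∧
    (∀ x, 0 ≤ T x) ∧ (∀ x, (Finset.univ.filter fun i => T x < |x i|).card ≤ k) ∧
    ∀ x τ, 0 ≤ τ → (Finset.univ.filter fun i => τ < |x i|).card ≤ k → T x ≤ τ := by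
  set S : Finset (Finset (Fin n)) := Finset.univ.filter fun A => A.card ≤ k with hS
  have hSne : S.Nonempty := ⟨∅, by simp [hS]⟩
  -- Discard at most `k` coordinates so as to minimize the largest remaining one; a finite minimum
  -- of finite maxima is continuous.
  set T : (Fin n → ℝ) → NNReal := fun x => S.inf' hSne fun A => Aᶜ.sup fun i => ‖x i‖₊ with hT
  refine ⟨fun x => T x, ?_, fun x => (T x).2, fun x => ?_, fun x τ hτ hcard => ?_⟩
  · exact NNReal.continuous_coe.comp (Continuous.finset_inf'_apply hSne fun A _ =>
      Continuous.finset_sup_apply fun i _ => (continuous_apply i).nnnorm)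
  · obtain ⟨A, hA, hTA⟩ := Finset.exists_mem_eq_inf' hSne fun A => Aᶜ.sup fun i => ‖x i‖₊
    refine (Finset.card_le_card fun i hi => ?_).trans (Finset.mem_filter.1 hA).2
    by_contra hiA
    refine not_le.2 (Finset.mem_filter.1 hi).2 ?_
    have : ‖x i‖₊ ≤ T x := by
      simp only [hT]
      rw [hTA]
      exact Finset.le_sup (f := fun i => ‖x i‖₊) (Finset.mem_compl.2 hiA)
    exact_mod_cast this
  · have : T x ≤ ⟨τ, hτ⟩ := by
      refine (Finset.inf'_le (fun A : Finset (Fin n) => Aᶜ.sup fun i => ‖x i‖₊)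
        (Finset.mem_filter.2 ⟨Finset.mem_univ _, hcard⟩)).trans ?_
      refine Finset.sup_le fun i hi => ?_
      have : |x i| ≤ τ := by simpa using hi
      exact this
    exact this

lemma sum_rpow_le_one_of_mem_lpBall {p : ℝ} (hp : 1 ≤ p) {n : ℕ} {x : Fin n → ℝ}
    (hx : x ∈ lpBall p n) : ∑ i, |x i| ^ p ≤ 1 := by
  by_contra! h
  exact absurd hx (not_le.2 (Real.one_lt_rpow h (by positivity)))

lemma abs_le_one_of_mem_lpBall {p : ℝ} (hp : 1 ≤ p) {n : ℕ} {x : Fin n → ℝ}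
    (hx : x ∈ lpBall p n) (i : Fin n) : |x i| ≤ 1 := by
  by_contra! h
  refine absurd (sum_rpow_le_one_of_mem_lpBall hp hx) (not_le.2 ?_)
  refine (Real.one_lt_rpow h (by positivity : 0 < p)).trans_le ?_
  exact Finset.single_le_sum (f := fun i => |x i| ^ p) (fun i _ => by positivity)
    (Finset.mem_univ i)

lemma card_filter_lt_abs_le_of_mem_lpBall {p : ℝ} (hp : 1 ≤ p) {n : ℕ} {x : Fin n → ℝ}
    (hx : x ∈ lpBall p n) (k : ℕ) :
    (Finset.univ.filter fun i => ((k : ℝ) + 1) ^ (-(1 / p)) < |x i|).card ≤ k := by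
  by_contra! h
  refine absurd (sum_rpow_le_one_of_mem_lpBall hp hx) (not_le.2 ?_)
  have hk : (0 : ℝ) < k + 1 := by positivity
  have hτ : (((k : ℝ) + 1) ^ (-(1 / p))) ^ p = ((k : ℝ) + 1)⁻¹ := by
    rw [← Real.rpow_mul hk.le, ← Real.rpow_neg_one]
    congr 1
    field_simp
  set s := Finset.univ.filter fun i => ((k : ℝ) + 1) ^ (-(1 / p)) < |x i| with hs
  calc (1 : ℝ) = (k + 1) * ((k : ℝ) + 1)⁻¹ := by field_simp
    _ ≤ s.card * ((k : ℝ) + 1)⁻¹ := by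
      gcongr
      exact_mod_cast h
    _ = ∑ i ∈ s, ((k : ℝ) + 1)⁻¹ := by simp
    _ < ∑ i ∈ s, |x i| ^ p := by
      refine Finset.sum_lt_sum_of_nonempty (Finset.card_pos.1 (by omega)) fun i hi => ?_
      rw [← hτ]
      exact Real.rpow_lt_rpow (by positivity) (Finset.mem_filter.1 hi).2 (by positivity)
    _ ≤ ∑ i, |x i| ^ p :=
      Finset.sum_le_sum_of_subset_of_nonneg (Finset.subset_univ _) fun i _ _ => by positivity

lemma wdim_lpBall_le {p : ℝ} (hp : 1 ≤ p) {n k : ℕ} {ε : ℝ} (hε : 0 < ε)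
    (h : n ≤ k ∨ 2 * ((k : ℝ) + 1) ^ (-(1 / p)) ≤ ε) : wdim ε (lpBall p n) ≤ k := by
  obtain ⟨T, hTc, hT0, hTcard, hTle⟩ := exists_continuous_order_statistic n k
  have hTε : ∀ x ∈ lpBall p n, 2 * T x ≤ ε := by
    intro x hx
    rcases h with h | h
    · have := hTle x 0 le_rfl
        ((Finset.card_le_univ _).trans (by rwa [Fintype.card_fin]))
      linarith
    · have := hTle x _ (by positivity) (card_filter_lt_abs_le_of_mem_lpBall hp hx k)
      linarith
  -- Positive and negative parts of the thresholded coordinates. Division by `n + 1` keeps the total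
  -- at most 1, and the vertex `none` takes the rest.
  set P : lpBall p n → Fin n × Bool → ℝ := fun x q =>
    max ((if q.2 then x.1 q.1 else -x.1 q.1) - T x) 0 / (n + 1) with hP
  have hn : (0 : ℝ) < n + 1 := by positivity
  have hPc : ∀ q, Continuous fun x => P x q := by
    intro q
    have h1 : Continuous fun x : lpBall p n => x.1 q.1 :=
      (continuous_apply q.1).comp continuous_subtype_val
    have h2 : Continuous fun x : lpBall p n => T x := hTc.comp continuous_subtype_val
    refine Continuous.div_const (Continuous.max (Continuous.sub ?_ h2) continuous_const) _
    split_ifs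
    exacts [h1, h1.neg]
  have hP0 : ∀ x q, 0 ≤ P x q := fun x q => div_nonneg (le_max_right _ _) hn.le
  have hP1 : ∀ x, ∑ q, P x q ≤ 1 := by
    intro x
    have hle : ∀ i, P x (i, true) + P x (i, false) ≤ 1 / (n + 1) := by
      intro i
      simp only [hP, if_true, Bool.false_eq_true, if_false]
      rw [← add_div]
      gcongr
      refine le_trans ?_ (abs_le_one_of_mem_lpBall hp x.2 i)
      have h1 := le_abs_self (x.1 i)
      have h2 := neg_le_abs (x.1 i)
      have h3 := hT0 x
      rcases max_cases (x.1 i - T x) 0 with h | h <;>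
        rcases max_cases (-x.1 i - T x) 0 with h' | h' <;> linarith
    rw [Fintype.sum_prod_type]
    simp only [Fintype.sum_bool]
    refine (Finset.sum_le_sum fun i _ => hle i).trans ?_
    rw [Finset.sum_const, Finset.card_univ, Fintype.card_fin, nsmul_eq_mul, mul_one_div,
      div_le_one hn]
    linarith
  refine wdim_le_of_barycentric (I := Option (Fin n × Bool))
    (w := fun x o => o.elim (1 - ∑ q, P x q) (P x)) ?_ ?_ ?_ ?_
  · refine continuous_pi fun o => ?_
    rcases o with _ | q
    · exact continuous_const.sub (continuous_finsetSum _ fun q _ => hPc q)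
    · exact hPc q
  · intro x
    refine ⟨fun o => ?_, ?_⟩
    · rcases o with _ | q
      · exact sub_nonneg.2 (hP1 x)
      · exact hP0 x q
    · rw [Fintype.sum_option]
      simp
  · intro x
    -- At most `k` coordinates exceed the threshold, each with one sign only; `none` is the (k+1)-st
    -- vertex.
    refine ⟨insert none ((Finset.univ.filter fun i => T x < |x.1 i|).image
      fun i => some (i, decide (0 < x.1 i))), ?_, ?_⟩
    · refine (Finset.card_insert_le _ _).trans (Nat.add_le_add_right ?_ 1)
      exact Finset.card_image_le.trans (hTcard x)
    · rintro (_ | ⟨i, s⟩) ho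
      · simp at ho
      · have hle : (if s then x.1 i else -x.1 i) - T x ≤ 0 := by
          by_contra! hlt
          apply ho
          have h3 := hT0 x
          refine Finset.mem_insert_of_mem (Finset.mem_image.2 ⟨i, ?_, ?_⟩)
          · rw [Finset.mem_filter]
            refine ⟨Finset.mem_univ _, lt_of_lt_of_le (sub_pos.1 hlt) ?_⟩
            split_ifs
            exacts [le_abs_self _, neg_le_abs _]
          · cases s
            · simp only [Bool.false_eq_true, if_false] at hlt
              simp only [show ¬ 0 < x.1 i by linarith, decide_false]
            · simp only [if_true] at hlt
              simp only [show 0 < x.1 i by linarith, decide_true]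
        simp only [Option.elim, hP, max_eq_right hle, zero_div]
  · intro x y hxy
    refine (dist_pi_le_iff hε.le).2 fun i => ?_
    have key : ∀ s : Bool, max ((if s then x.1 i else -x.1 i) - T x) 0 =
        max ((if s then y.1 i else -y.1 i) - T y) 0 := fun s =>
      (div_left_inj' hn.ne').1 (congrFun hxy (some (i, s)))
    have h1 := key true
    have h2 := key false
    simp only [if_true, Bool.false_eq_true, if_false] at h1 h2
    have hx := hTε x x.2
    have hy := hTε y y.2
    have hx0 := hT0 x
    have hy0 := hT0 y
    rw [Real.dist_eq, abs_le]
    -- A surviving coordinate changes by `|T x - T y|`, a vanishing one by at most `T x + T y`; both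
    -- are at most `ε`.
    rcases max_cases (x.1 i - T x) 0 with h | h <;>
      rcases max_cases (-x.1 i - T x) 0 with h' | h' <;>
      rcases max_cases (y.1 i - T y) 0 with g | g <;>
      rcases max_cases (-y.1 i - T y) 0 with g' | g' <;>
      constructor <;> linarith

end UpperBound

/-! ### Lower bound: an inscribed cube. -/

section LowerBound

open Geometry Set Topology

lemma cube_mem_lpBall {p : ℝ} (hp : 1 ≤ p) {n k : ℕ} (hk : 1 ≤ k) {t : Fin k → ℝ}
    (ht : t ∈ Icc (0 : Fin k → ℝ) 1) :
    (fun i : Fin n => if h : (i : ℕ) < k then (k : ℝ) ^ (-(1 / p)) * (2 * t ⟨i, h⟩ - 1) else 0) ∈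
      lpBall p n := by
  have hk0 : (0 : ℝ) < k := by exact_mod_cast hk
  have hp0 : 0 < p := by positivity
  refine Real.rpow_le_one (Finset.sum_nonneg fun i _ => by positivity) ?_ (by positivity)
  have hr : ((k : ℝ) ^ (-(1 / p))) ^ p = (k : ℝ)⁻¹ := by
    rw [← Real.rpow_mul hk0.le, ← Real.rpow_neg_one]
    congr 1
    field_simp
  calc _ ≤ ∑ i : Fin n, if (i : ℕ) < k then (k : ℝ)⁻¹ else 0 := by
        refine Finset.sum_le_sum fun i _ => ?_
        dsimp only
        split_ifs with h
        · rw [← hr]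
          refine Real.rpow_le_rpow (abs_nonneg _) ?_ hp0.le
          rw [abs_mul, abs_of_nonneg (by positivity)]
          refine mul_le_of_le_one_right (by positivity) ?_
          have h0 : 0 ≤ t ⟨i, h⟩ := ht.1 ⟨i, h⟩
          have h1 : t ⟨i, h⟩ ≤ 1 := ht.2 ⟨i, h⟩
          rw [abs_le]; constructor <;> linarith
        · rw [abs_zero, Real.zero_rpow hp0.ne']
    _ = ∑ i ∈ (Finset.range n).filter (· < k), (k : ℝ)⁻¹ := by
        rw [Fin.sum_univ_eq_sum_range (fun i => if i < k then (k : ℝ)⁻¹ else 0) n,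
          Finset.sum_filter]
    _ = ((Finset.range n).filter (· < k)).card * (k : ℝ)⁻¹ := by simp
    _ ≤ k * (k : ℝ)⁻¹ := by
        gcongr
        refine (Finset.card_le_card fun i hi => ?_).trans_eq (Finset.card_range k)
        exact Finset.mem_range.2 (Finset.mem_filter.1 hi).2
    _ = 1 := by field_simp

lemma le_wdim_lpBall {p : ℝ} (hp : 1 ≤ p) {n k : ℕ} (hk : 1 ≤ k) (hkn : k ≤ n) {ε : ℝ}
    (hε : 0 < ε) (h : ε < 2 * (k : ℝ) ^ (-(1 / p))) : (k : ℕ∞) ≤ wdim ε (lpBall p n) := by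
  refine le_sInf ?_
  rintro d ⟨E, _, _, K, f, ⟨hf, hfib⟩, rfl⟩
  by_contra! hlt
  have hfaces : ∀ s ∈ K.faces, s.card ≤ (k - 1) + 1 := by
    intro s hs
    have : ((s.card - 1 : ℕ) : ℕ∞) < k :=
      (le_iSup₂ (f := fun (s : Finset E) (_ : s ∈ K.faces) => ((s.card - 1 : ℕ) : ℕ∞)) s hs).trans_lt
        hlt
    have : s.card - 1 < k := by exact_mod_cast this
    omega
  set c : Icc (0 : Fin k → ℝ) 1 → lpBall p n := fun t => ⟨_, cube_mem_lpBall hp hk t.2⟩ with hc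
  have hcc : Continuous c := by
    refine Continuous.subtype_mk (continuous_pi fun i => ?_) _
    split_ifs with h
    · exact continuous_const.mul ((continuous_const.mul
        ((continuous_apply _).comp continuous_subtype_val)).sub continuous_const)
    · exact continuous_const
  obtain ⟨V, b, hb, hbf, hdim⟩ :=
    SimplicialComplex.exists_continuous_dimH_range_le (hf.comp hcc) hfaces
  -- The retraction onto the cube extends the map to all of `ℝ^k`.
  set π : (Fin k → ℝ) → Icc (0 : Fin k → ℝ) 1 := fun x => ⟨fun i => max 0 (min 1 (x i)),
    fun i => le_max_left _ _, fun i => max_le zero_le_one (min_le_left _ _)⟩ with hπ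
  have hπc : Continuous π := Continuous.subtype_mk (continuous_pi fun i =>
    continuous_const.max (continuous_const.min (continuous_apply i))) _
  have hπid : ∀ x ∈ Icc (0 : Fin k → ℝ) 1, (π x).1 = x := by
    intro x hx
    funext i
    have h0 : 0 ≤ x i := hx.1 i
    have h1 : x i ≤ 1 := hx.2 i
    simp only [hπ]
    rw [min_eq_right h1, max_eq_right h0]
  obtain ⟨j, x, hx, y, hy, hxj, hyj, hxy⟩ := exists_opposite_faces_eq_of_dimH_lt
    (b := b ∘ π) (hb.comp hπc) (by
      refine (dimH_mono (?_ : _ ⊆ range b)).trans_lt (hdim.trans_lt ?_)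
      · rintro _ ⟨z, _, rfl⟩
        exact mem_range_self _
      · exact_mod_cast (by omega : k - 1 < k))
  have heq : f (c (π x)) = f (c (π y)) := hbf _ _ hxy
  have hdist : edist (c (π x)) (c (π y)) ≤ ENNReal.ofReal ε :=
    (Metric.edist_le_ediam_of_mem (s := f ⁻¹' {f (c (π y))}) heq rfl).trans (hfib _)
  rw [edist_dist, ENNReal.ofReal_le_ofReal_iff hε.le] at hdist
  -- On opposite faces the `j`-th coordinates are `∓ k^(-1/p)`, which are more than `ε` apart.
  have hcoord := (dist_le_pi_dist (c (π x)).1 (c (π y)).1 ⟨j, j.2.trans_le hkn⟩).trans hdist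
  simp only [hc, j.2, dif_pos, Fin.eta, hπid x hx, hπid y hy, hxj, hyj] at hcoord
  have hr : (0 : ℝ) ≤ (k : ℝ) ^ (-(1 / p)) := by positivity
  rw [Real.dist_eq, abs_le] at hcoord
  linarith [hcoord.1]

end LowerBound

theorem proposition1p2 (p : ℝ) (hp : 1 ≤ p) (n : ℕ) :
    wspec (lpBall p n) = {d : ℕ∞ | ∃ k : ℕ, k ≤ n ∧ d = (k : ℕ∞)} ∧
    ∀ ε : ℝ, 0 < ε →
      (2 ≤ ε → wdim ε (lpBall p n) = 0) ∧
      (∀ k : ℕ, 1 ≤ k → k < n →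
        2 * ((k : ℝ) + 1) ^ (-(1 / p)) ≤ ε → ε < 2 * (k : ℝ) ^ (-(1 / p)) →
        wdim ε (lpBall p n) = (k : ℕ∞)) ∧
      (ε < 2 * (n : ℝ) ^ (-(1 / p)) → wdim ε (lpBall p n) = (n : ℕ∞)) := by
  have hp0 : 0 < p := by positivity
  have values : ∀ ε : ℝ, 0 < ε →
      (2 ≤ ε → wdim ε (lpBall p n) = 0) ∧
      (∀ k : ℕ, 1 ≤ k → k < n →
        2 * ((k : ℝ) + 1) ^ (-(1 / p)) ≤ ε → ε < 2 * (k : ℝ) ^ (-(1 / p)) →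
        wdim ε (lpBall p n) = (k : ℕ∞)) ∧
      (ε < 2 * (n : ℝ) ^ (-(1 / p)) → wdim ε (lpBall p n) = (n : ℕ∞)) := by
    refine fun ε hε => ⟨fun h => ?_, fun k hk hkn h1 h2 => ?_, fun h => ?_⟩
    · have := wdim_lpBall_le hp (n := n) (k := 0) hε (Or.inr (by simpa using h))
      simpa using this
    · exact (wdim_lpBall_le hp hε (Or.inr h1)).antisymm (le_wdim_lpBall hp hk hkn.le hε h2)
    · refine (wdim_lpBall_le hp hε (Or.inl le_rfl)).antisymm ?_
      -- For `n = 0` the power `0 ^ (-(1 / p))` is 0 in Lean, so this case is vacuous; the bound is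
      -- trivial anyway.
      rcases Nat.eq_zero_or_pos n with rfl | hn
      · simp
      · exact le_wdim_lpBall hp hn le_rfl hε h
  refine ⟨Set.ext fun d => ⟨?_, ?_⟩, values⟩
  · rintro ⟨ε, hε, rfl⟩
    have hle := wdim_lpBall_le hp (n := n) hε (Or.inl le_rfl)
    obtain ⟨m, hm⟩ := ENat.ne_top_iff_exists.1 (ne_top_of_le_ne_top (ENat.natCast_ne_top n) hle)
    rw [← hm] at hle
    exact ⟨m, by exact_mod_cast hle, hm.symm⟩
  · rintro ⟨k, hkn, rfl⟩
    rcases Nat.eq_zero_or_pos k with rfl | hk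
    · exact ⟨2, two_pos, (values 2 two_pos).1 le_rfl⟩
    have hk0 : (0 : ℝ) < k := by exact_mod_cast hk
    rcases hkn.lt_or_eq with hkn | rfl
    · refine ⟨2 * ((k : ℝ) + 1) ^ (-(1 / p)), by positivity,
        (values _ (by positivity)).2.1 k hk hkn le_rfl ?_⟩
      gcongr 2 * ?_
      exact Real.rpow_lt_rpow_of_neg hk0 (by linarith) (neg_lt_zero.2 (by positivity))
    · have hpos : 0 < (k : ℝ) ^ (-(1 / p)) := by positivity
      exact ⟨_, hpos, (values _ hpos).2.2 (by linarith)⟩
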